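/- An $n\times n\times n$ binary image is a function $M:\{1,\dots,n\}^3\to\{0,1\}$; the triplets are its voxels. Two distinct voxels are adjacent if they differ by at most $1$ in each coordinate. The perimeter of $M$ is the set of voxels that are adjacent to a voxel of a different value or have some coordinate in $\{1,n\}$; $P_M$ is its size. Fix a constant $c\ge 1$. An image-affine transformation is a map $T(p)=\lfloor Ap+t\rfloor$ (coordinatewise floor), where $t\in\mathbb R^3$ and $A$ is a non-singular real $3\times 3$ matrix with $\|v\|_2/c\le\|Av\|_2\le c\|v\|_2$ for all $v\in\mathbb R^3$. Put $$\Delta_T(M_1,M_2)=\frac1{n^3}\Big(\big|\{p: T(p)\notin\{1,\dots,n\}^3\}\big|+\sum_{p:\,T(p)\in\{1,\dots,n\}^3}|M_1(p)-M_2(T(p))|\Big),$$ and let $\Delta(M_1,M_2)$ be the minimum of $\Delta_T(M_1,M_2)$ over all image-affine transformations $T$. **Corollary.** For every $c\ge 1$ there are constants $C_q,k$, depending only on $c$, and for every $K$ a constant $C_K$, depending only on $c$ and $K$, such that for all $n\ge 1$ and $\delta,\varepsilon>0$ there is a randomized algorithm, with oracle access to the values of the voxels of two $n\times n\times n$ binary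 images $M_1,M_2$, with the following properties. It always performs at most $$C_q\cdot x\cdot\log^k(2+x)=\tilde O\big(1/(\varepsilon^2\delta^{10})\big),\qquad x=\frac1{\varepsilon^2\delta^{10}},$$ queries, and for every $K$, if $P_{M_1}\le Kn^2$ and $P_{M_2}\le Kn^2$, then with probability at least $2/3$ it outputs a number $d$ with $|d-\Delta(M_1,M_2)|\le C_K(\delta+\varepsilon)$. -/

import Mathlib

namespace ImageMatching

/-- The voxels of an `n × n × n` image: the integer triplets in `{1, …, n}³`. -/
noncomputable def voxels (n : ℕ) : Finset (Fin 3 → ℤ) :=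
  Fintype.piFinset fun _ => Finset.Icc (1 : ℤ) (n : ℤ)

/-- A voxel of an `n × n × n` image. -/
abbrev Voxel (n : ℕ) : Type := {p : Fin 3 → ℤ // p ∈ voxels n}

/-- A 3-dimensional binary (`0-1`) image of size `n × n × n`. -/
abbrev BinImage (n : ℕ) : Type := Voxel n → Bool

/-- Two different voxels are adjacent if they differ in each coordinate by at most `1`. -/
def Adjacent {n : ℕ} (p q : Voxel n) : Prop :=
  p ≠ q ∧ ∀ i, |p.1 i - q.1 i| ≤ 1

/-- A boundary voxel of `M` is adjacent to a voxel of a different value. -/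
def IsBoundary {n : ℕ} (M : BinImage n) (p : Voxel n) : Prop :=
  ∃ q, Adjacent p q ∧ M p ≠ M q

/-- An outermost voxel of the cube. -/
def IsOuter {n : ℕ} (p : Voxel n) : Prop :=
  ∃ i, p.1 i = 1 ∨ p.1 i = (n : ℤ)

open Classical in
/-- The perimeter of `M`: its boundary voxels together with the outermost voxels. -/
noncomputable def perimeter {n : ℕ} (M : BinImage n) : Finset (Voxel n) :=
  Finset.univ.filter fun p => IsBoundary M p ∨ IsOuter p

/-- The linear map `v ↦ A v` has scaling factor in `[1/c, c]` for the Euclidean norm. -/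
def HasScaling (c : ℝ) (A : Matrix (Fin 3) (Fin 3) ℝ) : Prop :=
  ∀ v : EuclideanSpace ℝ (Fin 3),
    ‖v‖ / c ≤ ‖A.toEuclideanLin v‖ ∧ ‖A.toEuclideanLin v‖ ≤ c * ‖v‖

/-- The image-affine transformation `p ↦ ⌊A p + t⌋` based on `A` and `t`. -/
noncomputable def imageAffine (A : Matrix (Fin 3) (Fin 3) ℝ) (t : Fin 3 → ℝ)
    (p : Fin 3 → ℤ) : Fin 3 → ℤ :=
  fun i => ⌊(A.mulVec (fun j => (p j : ℝ)) + t) i⌋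

open Classical in
/-- `Δ_T(M₁, M₂)`: the fraction of voxels `p` of `M₁` that `T` maps outside `M₂`, or to a voxel of
`M₂` of a different value. -/
noncomputable def distAlong {n : ℕ} (T : (Fin 3 → ℤ) → (Fin 3 → ℤ)) (M₁ M₂ : BinImage n) : ℝ :=
  (((Finset.univ.filter fun p : Voxel n => T p.1 ∉ voxels n).card : ℝ) +
    ((Finset.univ.filter fun p : Voxel n =>
      ∃ h : T p.1 ∈ voxels n, M₁ p ≠ M₂ ⟨T p.1, h⟩).card : ℝ)) / (n : ℝ) ^ 3

/-- The values `Δ_T(M₁, M₂)` over all image-affine `T` with scaling factor in `[1/c, c]`. -/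
def distValues {n : ℕ} (c : ℝ) (M₁ M₂ : BinImage n) : Set ℝ :=
  {d | ∃ (A : Matrix (Fin 3) (Fin 3) ℝ) (t : Fin 3 → ℝ), A.det ≠ 0 ∧ HasScaling c A ∧
    d = distAlong (imageAffine A t) M₁ M₂}

/-- `Δ(M₁, M₂)`: the minimum of `Δ_T(M₁, M₂)` over all image-affine transformations `T` with
scaling factor in `[1/c, c]`; see `imageDist_isLeast`. -/
noncomputable def imageDist {n : ℕ} (c : ℝ) (M₁ M₂ : BinImage n) : ℝ :=
  sInf (distValues c M₁ M₂)

theorem imageDist_isLeast {n : ℕ} {c : ℝ} (hc : 1 ≤ c) (M₁ M₂ : BinImage n) :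
    IsLeast (distValues c M₁ M₂) (imageDist c M₁ M₂) := by
  classical
  have hne : (distValues c M₁ M₂).Nonempty := by
    refine ⟨_, 1, 0, by simp, ?_, rfl⟩
    intro v
    have h : Matrix.toEuclideanLin (1 : Matrix (Fin 3) (Fin 3) ℝ) v = v := by
      ext i; simp
    rw [h]
    exact ⟨div_le_self (norm_nonneg v) hc, le_mul_of_one_le_left (norm_nonneg v) hc⟩
  have hfin : (distValues c M₁ M₂).Finite := by
    refine (Set.finite_range (fun x : Finset (Voxel n) × Finset (Voxel n) =>
      ((x.1.card : ℝ) + (x.2.card : ℝ)) / (n : ℝ) ^ 3)).subset ?_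
    rintro d ⟨A, t, -, -, rfl⟩
    exact ⟨(Finset.univ.filter fun p : Voxel n => imageAffine A t p.1 ∉ voxels n,
      Finset.univ.filter fun p : Voxel n =>
        ∃ h : imageAffine A t p.1 ∈ voxels n, M₁ p ≠ M₂ ⟨imageAffine A t p.1, h⟩), by
        simp only [distAlong]⟩
  exact ⟨hne.csInf_mem hfin, fun d hd => csInf_le hfin.bddBelow hd⟩

/-- A deterministic adaptive algorithm with oracle access to two images: it either stops with a real
output, or queries the value of a voxel in the first or in the second image and continues according
to the answer. -/
inductive QueryAlg (n : ℕ) : Type where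
  | done (r : ℝ) : QueryAlg n
  | queryFst (p : Voxel n) (next : Bool → QueryAlg n) : QueryAlg n
  | querySnd (p : Voxel n) (next : Bool → QueryAlg n) : QueryAlg n

/-- The output of the algorithm on the images `M₁`, `M₂`. -/
def QueryAlg.output {n : ℕ} (M₁ M₂ : BinImage n) : QueryAlg n → ℝ
  | .done r => r
  | .queryFst p next => (next (M₁ p)).output M₁ M₂
  | .querySnd p next => (next (M₂ p)).output M₁ M₂

/-- The number of queries that the algorithm performs on the images `M₁`, `M₂`. -/
def QueryAlg.queries {n : ℕ} (M₁ M₂ : BinImage n) : QueryAlg n → ℕ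
  | .done _ => 0
  | .queryFst p next => (next (M₁ p)).queries M₁ M₂ + 1
  | .querySnd p next => (next (M₂ p)).queries M₁ M₂ + 1

/-- A randomized query algorithm: a probability distribution on deterministic ones (the algorithm
obtained by fixing the coin tosses). -/
abbrev RandQueryAlg (n : ℕ) : Type := PMF (QueryAlg n)

/-- On every pair of images, and for every outcome of the coin tosses, at most `q` queries. -/
def RandQueryAlg.QueriesAtMost {n : ℕ} (𝒜 : RandQueryAlg n) (q : ℝ) : Prop :=
  ∀ a ∈ PMF.support 𝒜, ∀ M₁ M₂ : BinImage n, (a.queries M₁ M₂ : ℝ) ≤ q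

/-- The probability that the output on `M₁`, `M₂` differs from `d` by at most `η`. -/
noncomputable def RandQueryAlg.probWithin {n : ℕ} (𝒜 : RandQueryAlg n) (M₁ M₂ : BinImage n)
    (d η : ℝ) : ENNReal :=
  PMF.toOuterMeasure 𝒜 {a | |a.output M₁ M₂ - d| ≤ η}

end ImageMatching

namespace ImageMatching

open Finset

open scoped Pointwise symmDiff

/-! Read both images on a grid of spacing `s = ⌈δn⌉` with a uniformly random offset, rebuild each
image by giving a voxel the value at the grid point below it, and output the exact distance of the
rebuilt images; only queries are counted, so this minimisation is free.

For a fixed voxel `p`, the displacement to its grid point is uniform on `[0, s)³`. The expected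
number of wrong voxels is thus an average of `#{p | M p ≠ M (p - j)}` over `j`, and walking from `p`
to `p - j` by unit steps bounds it by `6(s - 1)` times the perimeter, which is `O(K δ n³)`
(`sum_diffCount_gridImage_le`). The distance is Lipschitz in the images, because an image-affine map
sends boundedly many voxels to one voxel (`abs_imageDist_sub_le`). Markov's inequality then gives
probability `2/3`. The grid does not depend on `K`.

For `δ, ε ≤ 1` the number of queries is at most `16/δ³ ≤ 16/(ε²δ¹⁰)`, so no logarithm is needed.
Otherwise `δ + ε ≥ 1` and the constant answer `0` suffices. -/

/-! ### Reading a finite set of voxels -/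

/-- A function of two images that depends only on the voxels of a list can be computed by querying
these voxels in both images. -/
theorem exists_queryAlg_of_dependsOn {n : ℕ} (L : List (Voxel n))
    (F : BinImage n → BinImage n → ℝ)
    (hF : ∀ M₁ M₂ N₁ N₂ : BinImage n, (∀ p ∈ L, M₁ p = N₁ p) → (∀ p ∈ L, M₂ p = N₂ p) →
      F M₁ M₂ = F N₁ N₂) :
    ∃ a : QueryAlg n, ∀ M₁ M₂, a.output M₁ M₂ = F M₁ M₂ ∧ a.queries M₁ M₂ = 2 * L.length := by
  classical
  induction L generalizing F with
  | nil =>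
    refine ⟨.done (F (fun _ => false) (fun _ => false)), fun M₁ M₂ => ⟨?_, rfl⟩⟩
    exact hF _ _ _ _ (by simp) (by simp)
  | cons p L ih =>
    -- Overwriting both images at `p` by the answers leaves a function that depends only on the
    -- voxels of the tail.
    have key : ∀ b₁ b₂ : Bool, ∃ a : QueryAlg n, ∀ M₁ M₂,
        a.output M₁ M₂ = F (Function.update M₁ p b₁) (Function.update M₂ p b₂) ∧
          a.queries M₁ M₂ = 2 * L.length := by
      intro b₁ b₂
      refine ih _ fun M₁ M₂ N₁ N₂ h₁ h₂ => hF _ _ _ _ ?_ ?_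
      · intro q hq
        by_cases hqp : q = p
        · subst hqp; simp
        · simpa [hqp] using h₁ q ((List.mem_cons.1 hq).resolve_left hqp)
      · intro q hq
        by_cases hqp : q = p
        · subst hqp; simp
        · simpa [hqp] using h₂ q ((List.mem_cons.1 hq).resolve_left hqp)
    choose a ha using key
    refine ⟨.queryFst p fun b₁ => .querySnd p fun b₂ => a b₁ b₂, fun M₁ M₂ => ⟨?_, ?_⟩⟩
    · simp [QueryAlg.output, (ha _ _ _ _).1]
    · simp only [QueryAlg.queries, (ha _ _ _ _).2, List.length_cons]
      ring

/-! ### Translates of an image -/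

/-- The extension of an image to `ℤ³` by `false`. -/
noncomputable def extend {n : ℕ} (M : BinImage n) (p : Fin 3 → ℤ) : Bool :=
  open Classical in if h : p ∈ voxels n then M ⟨p, h⟩ else false

/-- The voxels of value `true`. -/
noncomputable def body {n : ℕ} (M : BinImage n) : Finset (Fin 3 → ℤ) :=
  (voxels n).filter fun p => extend M p = true

theorem extend_of_mem {n : ℕ} (M : BinImage n) {p : Fin 3 → ℤ} (h : p ∈ voxels n) :
    extend M p = M ⟨p, h⟩ := by
  simp [extend, h]

theorem mem_body {n : ℕ} {M : BinImage n} {p : Fin 3 → ℤ} :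
    p ∈ body M ↔ extend M p = true := by
  rw [body, mem_filter, and_iff_right_iff_imp]
  intro h
  by_contra hp
  simp [extend, hp] at h

/-- The number of points of `ℤ³` in exactly one of `S` and its translate by `j`. -/
def translateDiff (S : Finset (Fin 3 → ℤ)) (j : Fin 3 → ℤ) : ℕ := (S ∆ (j +ᵥ S)).card

/-- Triangle inequality for symmetric differences, with the invariance of cardinality under
translation. -/
theorem translateDiff_add_le (S : Finset (Fin 3 → ℤ)) (j k : Fin 3 → ℤ) :
    translateDiff S (j + k) ≤ translateDiff S j + translateDiff S k := by
  have h : ((j +ᵥ S) ∆ (j +ᵥ (k +ᵥ S))).card = (S ∆ (k +ᵥ S)).card := by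
    rw [← Finset.vadd_finset_symmDiff, Finset.card_vadd_finset]
  unfold translateDiff
  rw [← h, add_vadd]
  refine (card_le_card ?_).trans (card_union_le _ _)
  exact symmDiff_triangle S (j +ᵥ S) (j +ᵥ (k +ᵥ S))

theorem translateDiff_nsmul_le (S : Finset (Fin 3 → ℤ)) (j : Fin 3 → ℤ) (m : ℕ) :
    translateDiff S (m • j) ≤ m * translateDiff S j := by
  induction m with
  | zero => simp [translateDiff]
  | succ m ih =>
    rw [succ_nsmul, add_mul, one_mul]
    exact (translateDiff_add_le _ _ _).trans (by gcongr)

/-- A unit step out of the body either reaches a voxel of value `false`, so `p` is a boundary voxel,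
or leaves the cube, so `p` is outermost. The outermost voxels in the perimeter serve the second
case. -/
theorem mem_perimeter_of_step {n : ℕ} (M : BinImage n) {p q : Fin 3 → ℤ} (i : Fin 3)
    (hpq : (p = q + Pi.single i 1) ∨ (q = p + Pi.single i 1))
    (hp : p ∈ body M) (hq : q ∉ body M) :
    p ∈ (perimeter M).image Subtype.val := by
  classical
  have hpv : p ∈ voxels n := (mem_filter.1 hp).1
  rw [mem_body] at hp hq
  refine mem_image.2 ⟨⟨p, hpv⟩, ?_, rfl⟩
  rw [perimeter, mem_filter]
  refine ⟨mem_univ _, ?_⟩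
  have hne : ∀ k, k ≠ i → q k = p k := by
    intro k hk
    rcases hpq with h | h <;> simp [h, hk]
  have hi : p i = q i + 1 ∨ q i = p i + 1 := by
    rcases hpq with h | h <;> simp [h]
  by_cases hqv : q ∈ voxels n
  · left
    refine ⟨⟨q, hqv⟩, ⟨?_, ?_⟩, ?_⟩
    · intro h
      rw [Subtype.mk.injEq] at h
      rw [h] at hi
      omega
    · intro k
      by_cases hk : k = i
      · subst hk
        rw [abs_le]
        constructor <;> rcases hi with h | h <;> simp only [h] <;> omega
      · simp [hne k hk]
    · rw [← extend_of_mem M hpv, ← extend_of_mem M hqv, hp]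
      exact fun h => hq h.symm
  · right
    refine ⟨i, ?_⟩
    have hpv' := hpv
    simp only [voxels, Fintype.mem_piFinset, mem_Icc] at hpv' hqv
    push Not at hqv
    obtain ⟨k, hk⟩ := hqv
    have hki : k = i := by
      by_contra hki
      rw [hne k hki] at hk
      have := hpv' k
      have := hk this.1
      omega
    subst hki
    have := hpv' k
    by_cases h1 : 1 ≤ q k
    · have := hk h1
      simp only
      omega
    · simp only
      omega

/-- Both halves of the symmetric difference come from body points with a neighbour outside the body:
one half lies in the perimeter, the other in its translate. -/
theorem translateDiff_single_le {n : ℕ} (M : BinImage n) (i : Fin 3) :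
    translateDiff (body M) (Pi.single i 1) ≤ 2 * (perimeter M).card := by
  classical
  set e : Fin 3 → ℤ := Pi.single i 1 with he
  set P := (perimeter M).image Subtype.val with hP
  have hPc : P.card ≤ (perimeter M).card := card_image_le
  have hsub : body M ∆ (e +ᵥ body M) ⊆ P ∪ (e +ᵥ P) := by
    intro p hp
    rw [mem_symmDiff] at hp
    rcases hp with ⟨h1, h2⟩ | ⟨h1, h2⟩
    · refine mem_union_left _ (mem_perimeter_of_step M (q := -e + p) i (Or.inl ?_) h1 ?_)
      · simp [he]
      · intro h
        exact h2 (mem_vadd_finset.2 ⟨_, h, by simp⟩)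
    · obtain ⟨q, hq, rfl⟩ := mem_vadd_finset.1 h1
      refine mem_union_right _ (vadd_mem_vadd_finset
        (mem_perimeter_of_step M (q := e +ᵥ q) i (Or.inr ?_) hq h2))
      simp [he, add_comm]
  have := (card_le_card hsub).trans (card_union_le _ _)
  rw [card_vadd_finset] at this
  unfold translateDiff
  omega

/-- Three axes, at most `m` unit steps along each, and cost `2 * (perimeter M).card` per step. -/
theorem translateDiff_le {n : ℕ} (M : BinImage n) {m : ℕ} {j : Fin 3 → ℤ}
    (hj : ∀ i, 0 ≤ j i ∧ j i ≤ m) :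
    translateDiff (body M) j ≤ 6 * m * (perimeter M).card := by
  have key : ∀ i, translateDiff (body M) (Pi.single i (j i)) ≤ m * (2 * (perimeter M).card) := by
    intro i
    have h : (Pi.single i (j i) : Fin 3 → ℤ) = (j i).toNat • Pi.single i 1 := by
      rw [← Pi.single_smul]
      simp [(hj i).1]
    rw [h]
    refine (translateDiff_nsmul_le _ _ _).trans (Nat.mul_le_mul ?_ (translateDiff_single_le M i))
    have := hj i
    omega
  have hsum : j = Pi.single 0 (j 0) + Pi.single 1 (j 1) + Pi.single 2 (j 2) := by
    rw [← Fin.sum_univ_three (fun i => (Pi.single i (j i) : Fin 3 → ℤ)), univ_sum_single]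
  have h1 := translateDiff_add_le (body M) (Pi.single 0 (j 0) + Pi.single 1 (j 1))
    (Pi.single 2 (j 2))
  have h2 := translateDiff_add_le (body M) (Pi.single 0 (j 0)) (Pi.single 1 (j 1))
  rw [← hsum] at h1
  have := key 0
  have := key 1
  have := key 2
  linarith

/-! ### Reconstruction from a grid -/

/-- The largest point below `p` on the grid of spacing `s` through `u`. -/
def gridFloor (s : ℕ) (u p : Fin 3 → ℤ) : Fin 3 → ℤ := fun i => p i - (p i - u i) % (s : ℤ)

/-- The image whose value at `p` is the value of `M` at the grid point below `p`. -/
noncomputable def gridImage {n : ℕ} (s : ℕ) (u : Fin 3 → ℤ) (M : BinImage n) : BinImage n :=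
  fun p => extend M (gridFloor s u p.1)

/-- The number of voxels on which two images differ. -/
noncomputable def diffCount {n : ℕ} (M N : BinImage n) : ℕ := (univ.filter fun p => M p ≠ N p).card

theorem diffCount_comm {n : ℕ} (M N : BinImage n) : diffCount M N = diffCount N M := by
  simp [diffCount, ne_comm]

/-- The possible offsets of a grid of spacing `s`. -/
noncomputable def offsets (s : ℕ) : Finset (Fin 3 → ℤ) := Fintype.piFinset fun _ => Ico 0 (s : ℤ)

theorem card_filter_extend_ne_le {n : ℕ} (M : BinImage n) (j : Fin 3 → ℤ) :
    (univ.filter fun p : Voxel n => M p ≠ extend M (p.1 - j)).card ≤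
      translateDiff (body M) j := by
  refine card_le_card_of_injOn Subtype.val ?_ Subtype.val_injective.injOn
  intro p hp
  have hp : M p ≠ extend M (p.1 - j) := (mem_filter.1 (mem_coe.1 hp)).2
  rw [← extend_of_mem M p.2] at hp
  have h2 : p.1 ∈ j +ᵥ body M ↔ extend M (p.1 - j) = true := by
    rw [← mem_body, mem_vadd_finset]
    constructor
    · rintro ⟨y, hy, h⟩
      rw [← h]
      simpa using hy
    · intro h
      exact ⟨_, h, by simp⟩
  rw [mem_coe, mem_symmDiff, h2, mem_body]
  revert hp
  cases extend M p.1 <;> cases extend M (p.1 - j) <;> simp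

/-- Double counting: for fixed `p`, the map `u ↦ (p - u) mod (m + 1)` is an involution of the
offsets, so summing over offsets is summing over displacements `j` with coordinates in `[0, m]`. -/
theorem sum_diffCount_gridImage_le {n : ℕ} (M : BinImage n) (m : ℕ) :
    ∑ u ∈ offsets (m + 1), diffCount M (gridImage (m + 1) u M) ≤
      (offsets (m + 1)).card * (6 * m * (perimeter M).card) := by
  classical
  have hs : (0 : ℤ) < ((m + 1 : ℕ) : ℤ) := by positivity
  have h1 : ∑ u ∈ offsets (m + 1), diffCount M (gridImage (m + 1) u M) =
      ∑ j ∈ offsets (m + 1), (univ.filter fun p : Voxel n => M p ≠ extend M (p.1 - j)).card := by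
    simp only [diffCount, card_filter]
    rw [sum_comm, sum_comm (s := offsets (m + 1))]
    refine sum_congr rfl fun p _ => ?_
    have hmem : ∀ u ∈ offsets (m + 1),
        (fun i => (p.1 i - u i) % ((m + 1 : ℕ) : ℤ)) ∈ offsets (m + 1) := by
      intro u _
      rw [offsets, Fintype.mem_piFinset]
      intro i
      exact mem_Ico.2 ⟨Int.emod_nonneg _ hs.ne', Int.emod_lt_of_pos _ hs⟩
    have hinv : ∀ u ∈ offsets (m + 1),
        (fun i => (p.1 i - (p.1 i - u i) % ((m + 1 : ℕ) : ℤ)) % ((m + 1 : ℕ) : ℤ)) = u := by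
      intro u hu
      funext i
      have hi := mem_Ico.1 (Fintype.mem_piFinset.1 hu i)
      rw [Int.sub_emod, Int.emod_emod, ← Int.sub_emod, sub_sub_cancel]
      exact Int.emod_eq_of_lt hi.1 hi.2
    exact sum_nbij' (fun u i => (p.1 i - u i) % ((m + 1 : ℕ) : ℤ))
      (fun u i => (p.1 i - u i) % ((m + 1 : ℕ) : ℤ)) hmem hmem hinv hinv fun u _ => rfl
  rw [h1]
  refine sum_le_card_nsmul _ _ _ fun j hj => ?_
  refine (card_filter_extend_ne_le M j).trans (translateDiff_le M fun i => ?_)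
  have := mem_Ico.1 (Fintype.mem_piFinset.1 hj i)
  push_cast at this
  omega

/-- The voxels on the grid of spacing `s` through `u`. -/
noncomputable def gridVoxels (n s : ℕ) (u : Fin 3 → ℤ) : Finset (Voxel n) :=
  univ.filter fun p => ∀ i, p.1 i ≡ u i [ZMOD s]

theorem gridFloor_modEq (s : ℕ) (u p : Fin 3 → ℤ) (i : Fin 3) :
    gridFloor s u p i ≡ u i [ZMOD s] := by
  have h : p i - (p i - u i) % (s : ℤ) ≡ p i - (p i - u i) [ZMOD s] :=
    Int.ModEq.sub rfl (Int.mod_modEq _ _)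
  rwa [sub_sub_cancel] at h

theorem gridImage_congr {n s : ℕ} {u : Fin 3 → ℤ} {M N : BinImage n}
    (h : ∀ p ∈ gridVoxels n s u, M p = N p) : gridImage s u M = gridImage s u N := by
  funext p
  by_cases hp : gridFloor s u p.1 ∈ voxels n
  · rw [gridImage, gridImage, extend_of_mem M hp, extend_of_mem N hp]
    exact h _ (mem_filter.2 ⟨mem_univ _, gridFloor_modEq s u p.1⟩)
  · simp [gridImage, extend, hp]

theorem card_filter_modEq_le (n s : ℕ) (hs : 0 < s) (v : ℤ) :
    (((Icc (1 : ℤ) n).filter fun x => x ≡ v [ZMOD s]).card : ℝ) ≤ n / s + 1 := by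
  have hs' : (0 : ℤ) < s := by exact_mod_cast hs
  have h := Int.Ioc_filter_modEq_card 0 (n : ℤ) hs' v
  have hI : Ioc (0 : ℤ) n = Icc (1 : ℤ) n := by ext; simp [Int.lt_iff_add_one_le]
  rw [hI] at h
  have hle : (((Icc (1 : ℤ) n).filter fun x => x ≡ v [ZMOD s]).card : ℚ) ≤ n / s + 1 := by
    have h' : (((Icc (1 : ℤ) n).filter fun x => x ≡ v [ZMOD s]).card : ℚ) =
      ((max (⌊((n : ℤ) - v : ℚ) / (s : ℤ)⌋ - ⌊((0 : ℤ) - v : ℚ) / (s : ℤ)⌋) 0 : ℤ) : ℚ) := by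
      exact_mod_cast h
    rw [h']
    push_cast
    refine max_le ?_ (by positivity)
    have a1 := Int.floor_le (((n : ℚ) - v) / s)
    have a2 := Int.lt_floor_add_one ((0 - v : ℚ) / s)
    rw [sub_div] at a1 a2
    simp only [zero_div] at a2
    rw [sub_div, sub_div]
    simp only [zero_div]
    linarith
  have := (Rat.cast_le (K := ℝ)).2 hle
  push_cast at this
  exact this

theorem card_gridVoxels_le (n s : ℕ) (hs : 0 < s) (u : Fin 3 → ℤ) :
    ((gridVoxels n s u).card : ℝ) ≤ ((n : ℝ) / s + 1) ^ 3 := by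
  have h : (gridVoxels n s u).card ≤
      (Fintype.piFinset fun i => (Icc (1 : ℤ) n).filter fun x => x ≡ u i [ZMOD s]).card := by
    refine card_le_card_of_injOn Subtype.val ?_ Subtype.val_injective.injOn
    intro p hp
    have hp := (mem_filter.1 (mem_coe.1 hp)).2
    refine mem_coe.2 (Fintype.mem_piFinset.2 fun i => mem_filter.2 ⟨?_, hp i⟩)
    exact Fintype.mem_piFinset.1 p.2 i
  rw [Fintype.card_piFinset] at h
  calc ((gridVoxels n s u).card : ℝ)
      ≤ ∏ i, (((Icc (1 : ℤ) n).filter fun x => x ≡ u i [ZMOD s]).card : ℝ) := by exact_mod_cast h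
    _ ≤ ∏ _i : Fin 3, ((n : ℝ) / s + 1) :=
        prod_le_prod (fun _ _ => by positivity) fun i _ => card_filter_modEq_le n s hs (u i)
    _ = _ := by simp

/-! ### Stability of the distance -/

/-- A bound for the number of points that an image-affine transformation with scaling factor in
`[1/c, c]` maps to one voxel. -/
noncomputable def fiberBound (c : ℝ) : ℕ := (2 * ⌈2 * c⌉₊ + 1) ^ 3

/-- Equal floors force every coordinate of `A (p - q)` to be at most `1` in absolute value, so its
norm is at most `√3 ≤ 2`; the lower scaling bound gives `‖p - q‖ ≤ 2c`. -/
theorem abs_sub_le_of_imageAffine_eq {c : ℝ} (hc : 1 ≤ c) {A : Matrix (Fin 3) (Fin 3) ℝ}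
    (hA : HasScaling c A) {t : Fin 3 → ℝ} {p q : Fin 3 → ℤ}
    (h : imageAffine A t p = imageAffine A t q) (i : Fin 3) : |p i - q i| ≤ ⌈2 * c⌉₊ := by
  set v : EuclideanSpace ℝ (Fin 3) := WithLp.toLp 2 fun j => ((p j : ℝ) - q j) with hv
  have hcoord : ∀ k, |A.toEuclideanLin v k| ≤ 1 := by
    intro k
    have h1 : A.toEuclideanLin v k = (A.mulVec (fun j => (p j : ℝ)) + t) k -
        (A.mulVec (fun j => (q j : ℝ)) + t) k := by
      have : (fun j => ((p j : ℝ) - q j)) = (fun j => (p j : ℝ)) - fun j => (q j : ℝ) := rfl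
      simp [hv, this, Matrix.toLpLin_toLp]
    rw [h1]
    exact (Int.abs_sub_lt_one_of_floor_eq_floor (congrFun h k)).le
  have hnorm : ‖A.toEuclideanLin v‖ ≤ 2 := by
    rw [EuclideanSpace.norm_eq, Real.sqrt_le_left (by norm_num), Fin.sum_univ_three]
    have hsq : ∀ k, ‖A.toEuclideanLin v k‖ ^ 2 ≤ 1 := fun k => by
      rw [Real.norm_eq_abs]
      exact pow_le_one₀ (abs_nonneg _) (hcoord k)
    linarith [hsq 0, hsq 1, hsq 2]
  have hv2 : ‖v‖ ≤ 2 * c := by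
    have := ((hA v).1.trans hnorm)
    rwa [div_le_iff₀ (by linarith)] at this
  have hvi : |((p i : ℝ) - q i)| ≤ 2 * c := by
    have := PiLp.norm_apply_le v i
    rw [Real.norm_eq_abs] at this
    exact this.trans hv2
  have : ((|p i - q i| : ℤ) : ℝ) ≤ ((⌈2 * c⌉₊ : ℕ) : ℝ) := by
    push_cast
    exact hvi.trans (Nat.le_ceil _)
  exact_mod_cast this

theorem card_fiber_imageAffine_le {n : ℕ} {c : ℝ} (hc : 1 ≤ c) {A : Matrix (Fin 3) (Fin 3) ℝ}
    (hA : HasScaling c A) (t : Fin 3 → ℝ) (S : Finset (Voxel n)) (q : Fin 3 → ℤ) :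
    (S.filter fun p => imageAffine A t p.1 = q).card ≤ fiberBound c := by
  rcases (S.filter fun p => imageAffine A t p.1 = q).eq_empty_or_nonempty with h | ⟨p₀, hp₀⟩
  · simp [h]
  set m : ℤ := ((⌈2 * c⌉₊ : ℕ) : ℤ) with hm
  have hcard : (Fintype.piFinset fun i => Icc (p₀.1 i - m) (p₀.1 i + m)).card = fiberBound c := by
    rw [Fintype.card_piFinset]
    have : ∀ i, (p₀.1 i + m + 1 - (p₀.1 i - m)).toNat = 2 * ⌈2 * c⌉₊ + 1 := by
      intro i
      omega
    simp [this, fiberBound]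
  rw [← hcard]
  refine card_le_card_of_injOn Subtype.val ?_ Subtype.val_injective.injOn
  intro p hp
  have hp := (mem_filter.1 (mem_coe.1 hp)).2
  refine mem_coe.2 (Fintype.mem_piFinset.2 fun i => mem_Icc.2 ?_)
  have h := abs_le.1
    (abs_sub_le_of_imageAffine_eq hc hA (hp.trans (mem_filter.1 hp₀).2.symm) i)
  rw [← hm] at h
  omega

/-- The voxels mapped outside the cube are the same for both pairs. A new mismatch at `p` needs a
change of the first image at `p` or of the second at `T p`; each changed voxel of the second image
accounts for at most `fiberBound c` such `p`. -/
theorem distAlong_le {n : ℕ} {c : ℝ} (hc : 1 ≤ c) {A : Matrix (Fin 3) (Fin 3) ℝ}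
    (hA : HasScaling c A) (t : Fin 3 → ℝ) (M₁ M₂ N₁ N₂ : BinImage n) :
    distAlong (imageAffine A t) M₁ M₂ ≤ distAlong (imageAffine A t) N₁ N₂ +
      (diffCount M₁ N₁ + fiberBound c * diffCount M₂ N₂ : ℝ) / (n : ℝ) ^ 3 := by
  classical
  set T := imageAffine A t with hT
  set X := univ.filter fun p : Voxel n => ∃ h : T p.1 ∈ voxels n, M₂ ⟨T p.1, h⟩ ≠ N₂ ⟨T p.1, h⟩
    with hX
  have hXcard : X.card ≤ fiberBound c * diffCount M₂ N₂ := by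
    have hmap : ∀ p ∈ X, T p.1 ∈
        (univ.filter fun q : Voxel n => M₂ q ≠ N₂ q).image Subtype.val := by
      intro p hp
      obtain ⟨h, hne⟩ := (mem_filter.1 hp).2
      exact mem_image.2 ⟨⟨T p.1, h⟩, mem_filter.2 ⟨mem_univ _, hne⟩, rfl⟩
    refine (card_le_mul_card_image_of_maps_to hmap (fiberBound c)
      fun q _ => card_fiber_imageAffine_le hc hA t X q).trans ?_
    exact Nat.mul_le_mul_left _ card_image_le
  have hsub : (univ.filter fun p : Voxel n => ∃ h : T p.1 ∈ voxels n, M₁ p ≠ M₂ ⟨T p.1, h⟩) ⊆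
      (univ.filter fun p : Voxel n => ∃ h : T p.1 ∈ voxels n, N₁ p ≠ N₂ ⟨T p.1, h⟩) ∪
        ((univ.filter fun p => M₁ p ≠ N₁ p) ∪ X) := by
    intro p hp
    obtain ⟨h, hne⟩ := (mem_filter.1 hp).2
    simp only [mem_union, mem_filter, mem_univ, true_and, hX]
    by_cases h1 : M₁ p = N₁ p
    · by_cases h2 : M₂ ⟨T p.1, h⟩ = N₂ ⟨T p.1, h⟩
      · exact Or.inl ⟨h, by rwa [← h1, ← h2]⟩
      · exact Or.inr (Or.inr ⟨h, h2⟩)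
    · exact Or.inr (Or.inl h1)
  have hcard := (card_le_card hsub).trans
    ((card_union_le _ _).trans (Nat.add_le_add_left ((card_union_le _ _).trans
      (Nat.add_le_add_left hXcard _)) _))
  have hcard' : ((univ.filter fun p : Voxel n =>
      ∃ h : T p.1 ∈ voxels n, M₁ p ≠ M₂ ⟨T p.1, h⟩).card : ℝ) ≤
      (univ.filter fun p : Voxel n => ∃ h : T p.1 ∈ voxels n, N₁ p ≠ N₂ ⟨T p.1, h⟩).card +
        (diffCount M₁ N₁ + fiberBound c * diffCount M₂ N₂ : ℝ) := by
    have : (univ.filter fun p => M₁ p ≠ N₁ p).card = diffCount M₁ N₁ := by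
      simp only [diffCount]
    rw [this] at hcard
    exact_mod_cast hcard
  unfold distAlong
  rw [← add_div]
  refine div_le_div_of_nonneg_right ?_ (by positivity)
  linarith

/-- The optimal transformation for `N₁, N₂` is a competitor for `M₁, M₂`. -/
theorem imageDist_le {n : ℕ} {c : ℝ} (hc : 1 ≤ c) (M₁ M₂ N₁ N₂ : BinImage n) :
    imageDist c M₁ M₂ ≤ imageDist c N₁ N₂ +
      (diffCount M₁ N₁ + fiberBound c * diffCount M₂ N₂ : ℝ) / (n : ℝ) ^ 3 := by
  obtain ⟨A, t, hdet, hA, h⟩ := (imageDist_isLeast hc N₁ N₂).1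
  rw [h]
  exact ((imageDist_isLeast hc M₁ M₂).2 ⟨A, t, hdet, hA, rfl⟩).trans
    (distAlong_le hc hA t M₁ M₂ N₁ N₂)

theorem abs_imageDist_sub_le {n : ℕ} {c : ℝ} (hc : 1 ≤ c) (M₁ M₂ N₁ N₂ : BinImage n) :
    |imageDist c N₁ N₂ - imageDist c M₁ M₂| ≤
      (diffCount M₁ N₁ + fiberBound c * diffCount M₂ N₂ : ℝ) / (n : ℝ) ^ 3 := by
  have h1 := imageDist_le hc M₁ M₂ N₁ N₂
  have h2 := imageDist_le hc N₁ N₂ M₁ M₂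
  rw [diffCount_comm N₁, diffCount_comm N₂] at h2
  rw [abs_le]
  constructor <;> linarith

theorem card_voxel (n : ℕ) : Fintype.card (Voxel n) = n ^ 3 := by
  rw [Fintype.card_coe, voxels, Fintype.card_piFinset]
  simp

theorem abs_imageDist_le {n : ℕ} {c : ℝ} (hc : 1 ≤ c) (M₁ M₂ : BinImage n) :
    |imageDist c M₁ M₂| ≤ 2 := by
  classical
  obtain ⟨A, t, -, -, h⟩ := (imageDist_isLeast hc M₁ M₂).1
  rw [h, distAlong, abs_of_nonneg (by positivity)]
  have hle : ∀ S : Finset (Voxel n), (S.card : ℝ) ≤ (n : ℝ) ^ 3 := by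
    intro S
    have := S.card_le_univ
    rw [card_voxel] at this
    exact_mod_cast this
  refine div_le_of_le_mul₀ (by positivity) (by norm_num) ?_
  rw [two_mul]
  exact add_le_add (hle _) (hle _)

/-! ### The algorithm -/

/-- Markov's inequality for the uniform distribution on `U`, at three times the bound `E` on the
mean. -/
theorem two_thirds_le_of_average_le {α : Type*} [DecidableEq α] (U : Finset α) (hU : U.Nonempty)
    (f : α → ℝ) (hf : ∀ u ∈ U, 0 ≤ f u) {E : ℝ} (hE : ∑ u ∈ U, f u ≤ U.card * E) :
    (2 / 3 : ENNReal) ≤ (U.filter fun u => f u ≤ 3 * E).card / U.card := by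
  have hUpos : (0 : ℝ) < U.card := by exact_mod_cast hU.card_pos
  have hE0 : 0 ≤ E := by
    by_contra hneg
    have := (sum_nonneg hf).trans hE
    nlinarith
  have hbad : 3 * (U.filter fun u => ¬ f u ≤ 3 * E).card ≤ U.card := by
    -- Markov's argument cancels `E`; if `E = 0`, all values vanish and there is no bad point.
    rcases hE0.eq_or_lt with h0 | hpos
    · subst h0
      have hz := (sum_eq_zero_iff_of_nonneg hf).1
        (le_antisymm (by simpa using hE) (sum_nonneg hf))
      rw [filter_false_of_mem fun u hu => by simp [hz u hu]]
      simp
    · have h1 : ((U.filter fun u => ¬ f u ≤ 3 * E).card : ℝ) * (3 * E) ≤ ∑ u ∈ U, f u := by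
        rw [← nsmul_eq_mul]
        refine (card_nsmul_le_sum _ f _ fun u hu => ?_).trans
          (sum_le_sum_of_subset_of_nonneg (filter_subset _ _) fun u hu _ => hf u hu)
        exact (not_le.1 (mem_filter.1 hu).2).le
      have h2 : (3 * (U.filter fun u => ¬ f u ≤ 3 * E).card : ℝ) ≤ U.card := by
        refine le_of_mul_le_mul_right ?_ hpos
        linarith
      exact_mod_cast h2
  have hgood : 2 * U.card ≤ 3 * (U.filter fun u => f u ≤ 3 * E).card := by
    have := card_filter_add_card_filter_not (s := U) (fun u => f u ≤ 3 * E)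
    omega
  rw [ENNReal.le_div_iff_mul_le (Or.inl (by simpa using hU.ne_empty)) (Or.inl (by simp)),
    ENNReal.mul_comm_div, ← mul_div_assoc]
  refine ENNReal.div_le_of_le_mul ?_
  rw [mul_comm _ (3 : ENNReal)]
  exact_mod_cast hgood

theorem exists_randQueryAlg {n : ℕ} {c : ℝ} (hc : 1 ≤ c) (m : ℕ) :
    ∃ 𝒜 : RandQueryAlg n,
      𝒜.QueriesAtMost (2 * ((n : ℝ) / (m + 1 : ℕ) + 1) ^ 3) ∧
      ∀ (M₁ M₂ : BinImage n) (η : ℝ),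
        3 * (6 * m * ((perimeter M₁).card + fiberBound c * (perimeter M₂).card) / (n : ℝ) ^ 3)
          ≤ η → 2 / 3 ≤ 𝒜.probWithin M₁ M₂ (imageDist c M₁ M₂) η := by
  classical
  set s := m + 1 with hs
  have hne : (offsets s).Nonempty := ⟨0, by simp [offsets, hs]⟩
  have halg : ∀ u : Fin 3 → ℤ, ∃ a : QueryAlg n, ∀ M₁ M₂,
      a.output M₁ M₂ = imageDist c (gridImage s u M₁) (gridImage s u M₂) ∧
        a.queries M₁ M₂ = 2 * (gridVoxels n s u).toList.length := by
    intro u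
    refine exists_queryAlg_of_dependsOn (gridVoxels n s u).toList
      (fun M₁ M₂ => imageDist c (gridImage s u M₁) (gridImage s u M₂)) ?_
    intro M₁ M₂ N₁ N₂ h₁ h₂
    simp only [mem_toList] at h₁ h₂
    rw [gridImage_congr h₁, gridImage_congr h₂]
  choose a ha using halg
  refine ⟨(PMF.uniformOfFinset (offsets s) hne).map a, ?_, ?_⟩
  · intro b hb M₁ M₂
    obtain ⟨u, -, rfl⟩ := (PMF.mem_support_map_iff _ _ _).1 hb
    rw [(ha u M₁ M₂).2, length_toList]
    push_cast
    have := card_gridVoxels_le n s (Nat.succ_pos m) u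
    linarith
  · intro M₁ M₂ η hη
    set E : ℝ := 6 * m * ((perimeter M₁).card + fiberBound c * (perimeter M₂).card) / (n : ℝ) ^ 3
      with hE
    let f : (Fin 3 → ℤ) → ℝ := fun u =>
      (diffCount M₁ (gridImage s u M₁) + fiberBound c * diffCount M₂ (gridImage s u M₂) : ℝ) /
        (n : ℝ) ^ 3
    have hsum : ∑ u ∈ offsets s, f u ≤ (offsets s).card * E := by
      have h1 : (∑ u ∈ offsets s, (diffCount M₁ (gridImage s u M₁) : ℝ)) ≤
          (offsets s).card * (6 * m * (perimeter M₁).card) := by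
        exact_mod_cast sum_diffCount_gridImage_le M₁ m
      have h2 : (∑ u ∈ offsets s, (diffCount M₂ (gridImage s u M₂) : ℝ)) ≤
          (offsets s).card * (6 * m * (perimeter M₂).card) := by
        exact_mod_cast sum_diffCount_gridImage_le M₂ m
      rw [← sum_div, sum_add_distrib, ← mul_sum, hE, ← mul_div_assoc]
      refine div_le_div_of_nonneg_right ?_ (by positivity)
      have h3 := mul_le_mul_of_nonneg_left h2 (Nat.cast_nonneg (α := ℝ) (fiberBound c))
      linarith
    have hprob := two_thirds_le_of_average_le (offsets s) hne f
      (fun u _ => by positivity) hsum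
    refine hprob.trans ?_
    rw [RandQueryAlg.probWithin, PMF.toOuterMeasure_map_apply,
      PMF.toOuterMeasure_uniformOfFinset_apply]
    gcongr with u hu
    intro hfu
    simp only [Set.mem_preimage, Set.mem_ofPred_eq, (ha u M₁ M₂).1]
    exact (abs_imageDist_sub_le hc M₁ M₂ _ _).trans (hfu.trans hη)

theorem exists_randQueryAlg_trivial {n : ℕ} {c : ℝ} (hc : 1 ≤ c) :
    ∃ 𝒜 : RandQueryAlg n, 𝒜.QueriesAtMost 0 ∧
      ∀ (M₁ M₂ : BinImage n) (η : ℝ), 2 ≤ η →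
        2 / 3 ≤ 𝒜.probWithin M₁ M₂ (imageDist c M₁ M₂) η := by
  refine ⟨PMF.pure (.done 0), ?_, ?_⟩
  · intro b hb M₁ M₂
    rw [PMF.support_pure, Set.mem_singleton_iff] at hb
    simp [hb, QueryAlg.queries]
  · intro M₁ M₂ η hη
    have hmem : QueryAlg.done 0 ∈
        {a : QueryAlg n | |a.output M₁ M₂ - imageDist c M₁ M₂| ≤ η} := by
      simpa [QueryAlg.output] using (abs_imageDist_le hc M₁ M₂).trans hη
    rw [RandQueryAlg.probWithin, PMF.toOuterMeasure_pure_apply, if_pos hmem]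
    exact ENNReal.div_le_of_le_mul (by norm_num)

end ImageMatching

theorem mainTheorem10 (c : ℝ) (hc : 1 ≤ c) :
    ∃ (Cq : ℝ) (k : ℕ) (Ce : ℝ → ℝ),
      ∀ (n : ℕ) (δ ε : ℝ), 0 < n → 0 < δ → 0 < ε →
        ∃ 𝒜 : ImageMatching.RandQueryAlg n,
          ImageMatching.RandQueryAlg.QueriesAtMost 𝒜
            (Cq * (1 / (ε ^ 2 * δ ^ 10)) * Real.log (2 + 1 / (ε ^ 2 * δ ^ 10)) ^ k) ∧
          ∀ (K : ℝ) (M₁ M₂ : ImageMatching.BinImage n),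
            ((ImageMatching.perimeter M₁).card : ℝ) ≤ K * (n : ℝ) ^ 2 →
            ((ImageMatching.perimeter M₂).card : ℝ) ≤ K * (n : ℝ) ^ 2 →
            2 / 3 ≤ ImageMatching.RandQueryAlg.probWithin 𝒜 M₁ M₂
              (ImageMatching.imageDist c M₁ M₂) (Ce K * (δ + ε)) := by
  -- `16 = 2 · 2³` is two images times `(n/s + 1)³ ≤ (2/δ)³`; `18 = 3 · 6` is Markov's factor times
  -- the translation constant; the summand `2` covers the constant answer.
  refine ⟨16, 0, fun K => 2 + 18 * (1 + ImageMatching.fiberBound c) * |K|, ?_⟩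
  intro n δ ε hn hδ hε
  have hn' : (0 : ℝ) < n := by exact_mod_cast hn
  have hx : 0 < 1 / (ε ^ 2 * δ ^ 10) := by positivity
  rw [pow_zero, mul_one]
  by_cases hsmall : δ ≤ 1 ∧ ε ≤ 1
  · obtain ⟨hδ1, hε1⟩ := hsmall
    -- With `m + 1 = ⌈δn⌉`, the bound `m ≤ δn` controls the error and `m + 1 ≥ δn` the number of
    -- queries. As `m`, not `m + 1`, enters the error, spacing `1` is exact.
    have hceil : 0 < ⌈δ * n⌉₊ := Nat.ceil_pos.2 (by positivity)
    obtain ⟨m, hm⟩ := Nat.exists_eq_succ_of_ne_zero hceil.ne'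
    have hmlt : (m : ℝ) ≤ δ * n := (Nat.lt_ceil.1 (by omega)).le
    have hmge : δ * n ≤ ((m + 1 : ℕ) : ℝ) := Nat.ceil_le.1 hm.le
    obtain ⟨𝒜, hq, hA⟩ := ImageMatching.exists_randQueryAlg (n := n) hc m
    refine ⟨𝒜, fun a ha M₁ M₂ => (hq a ha M₁ M₂).trans ?_, ?_⟩
    · have h1 : (n : ℝ) / (m + 1 : ℕ) ≤ 1 / δ := by
        rw [div_le_div_iff₀ (by positivity) hδ]
        linarith
      have h2 : (1 : ℝ) ≤ 1 / δ := (one_le_div hδ).2 hδ1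
      have h3 : ((n : ℝ) / (m + 1 : ℕ) + 1) ^ 3 ≤ (2 * (1 / δ)) ^ 3 := by
        gcongr
        linarith
      have h4 : (1 / δ) ^ 3 ≤ 1 / (ε ^ 2 * δ ^ 10) := by
        rw [one_div_pow]
        refine one_div_le_one_div_of_le (by positivity) ?_
        calc ε ^ 2 * δ ^ 10 ≤ 1 * δ ^ 3 := by
              gcongr ?_ * ?_
              · exact pow_le_one₀ hε.le hε1
              · exact pow_le_pow_of_le_one hδ.le hδ1 (by norm_num)
          _ = δ ^ 3 := one_mul _
      rw [mul_pow] at h3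
      linarith
    · intro K M₁ M₂ h₁ h₂
      refine hA M₁ M₂ _ ?_
      have hK : K ≤ |K| := le_abs_self K
      have hB : (0 : ℝ) ≤ ImageMatching.fiberBound c := Nat.cast_nonneg _
      have hP : ((ImageMatching.perimeter M₁).card + ImageMatching.fiberBound c *
          (ImageMatching.perimeter M₂).card : ℝ) ≤
          (1 + ImageMatching.fiberBound c) * (|K| * n ^ 2) := by
        have hKn : K * (n : ℝ) ^ 2 ≤ |K| * n ^ 2 := by gcongr
        have := mul_le_mul_of_nonneg_left (h₂.trans hKn) hB
        linarith
      have hE : 6 * m * ((ImageMatching.perimeter M₁).card + ImageMatching.fiberBound c *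
          (ImageMatching.perimeter M₂).card : ℝ) / (n : ℝ) ^ 3 ≤
          6 * (1 + ImageMatching.fiberBound c) * |K| * δ := by
        rw [div_le_iff₀ (by positivity)]
        calc 6 * m * ((ImageMatching.perimeter M₁).card + ImageMatching.fiberBound c *
              (ImageMatching.perimeter M₂).card : ℝ)
            ≤ 6 * (δ * n) * ((1 + ImageMatching.fiberBound c) * (|K| * n ^ 2)) := by gcongr
          _ = _ := by ring
      have hnn : 0 ≤ 18 * (1 + (ImageMatching.fiberBound c : ℝ)) * |K| * ε := by positivity
      linarith
  · obtain ⟨𝒜, hq, hA⟩ := ImageMatching.exists_randQueryAlg_trivial (n := n) hc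
    refine ⟨𝒜, fun a ha M₁ M₂ => (hq a ha M₁ M₂).trans (by positivity), ?_⟩
    intro K M₁ M₂ _ _
    refine hA M₁ M₂ _ ?_
    have hone : 1 ≤ δ + ε := by
      by_contra hlt
      exact hsmall ⟨by linarith, by linarith⟩
    have hnn : 0 ≤ 18 * (1 + (ImageMatching.fiberBound c : ℝ)) * |K| * (δ + ε) := by positivity
    linarith
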